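/- Let $b\ge 3$, $1\le s<b$, $m\ge 4b$ be integers, and put $r=2^b$ and $t=2b-s$. Let $z$ be an integer with $z\equiv m \pmod{2b-s}$ and $1\le z\le b$, and let $\ell$ be an integer with $$\frac{2^{m+s-1}-1}{2^{b-1}(2^{b}+1)}<\ell \le \frac{2^{m}-2^{2b-s}(2^z-1)-1}{2^{2b-s}-1}.$$ Then there is a partial $t$-spread $\{W_1,\dots,W_\ell\}$ of $\mathbb F_2^m$ of size $\ell$, that is, $\ell$ subspaces of dimension $t$ with $W_i\cap W_j=\{0\}$ for $i\ne j$. Call a $(s+t)\times r$ matrix $A=\binom{A_1}{A_2}$ over $\mathbb F_2$, with $A_1$ of size $s\times r$ and $A_2$ of size $t\times r$, a *desired matrix* if $2^t>r$, $t>s$, $A$ has rank $s+t$, any two columns of $A_2$ (at distinct positions) are linearly independent and, when $t\ge 3$, any four columns of $A$ (at distinct positions) are linearly independent. Let $A$ be any desired matrix of this size, $\{W_1,\dots,W_\ell\}$ any partial $t$-spread of $\mathbb F_2^m$ of size $\ell$, $G_{W_i}$ any $m\times t$ matrix whose columns form a basis of $W_i$, and $G_U$ any invertible $s\times s$ matrix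 over $\mathbb F_2$. Put $$G_{M_i}=\begin{pmatrix}G_U&0\\0&G_{W_i}\end{pmatrix},\qquad H_G^i=\bigl(\mathbf 0_{(s+m)\times 1},\ G_{M_i}A\bigr),\qquad H=\begin{pmatrix}H_1&\cdots&H_\ell\\ H_G^1&\cdots&H_G^\ell\end{pmatrix},$$ where $H_i$ is the $\ell\times(r+1)$ matrix whose $i$-th row is all-one and whose other rows are zero. Then the binary linear code $\mathcal C$ with parity check matrix $H$ has length $n=(r+1)\ell$, dimension $k=n-\ell-m-s$ and minimum distance $d\ge 6$. It is a locally repairable code with locality $r$: every coordinate $i$ has a set $R_i\not\ni i$ of at most $r$ coordinates with $c_i=\sum_{j\in R_i}c_j$ for all $c\in\mathcal C$. It has $\ell$ disjoint local repair groups: $\mathcal C^\perp$ contains $\ell$ vectors of weight $r+1$ with pairwise disjoint supports. And $\mathcal C$ is $k$-optimal: $2\le r\le \frac n2-2$ and $k$ is the largest integer not exceeding the upper bound for the dimension of binary linear LRCs with $d\geq 5$ and $2\le r\le\frac n2-2$, that is, $$k=\left\lfloor \frac{rn}{r+1}-\min\left\{\log_2\left(1+\frac{rn}{2}\right),\ \frac{rn}{(r+1)(r+2)}\right\}\right\rfloor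 .$$ -/

import Mathlib

namespace BinaryLRC

/-- A binary linear code whose coordinates are indexed by `ι`; its length is `Fintype.card ι`. -/
abbrev Code (ι : Type*) := Submodule (ZMod 2) (ι → ZMod 2)

section Codes

variable {ι : Type*} [Fintype ι]

/-- Minimum distance: the least Hamming weight of a nonzero codeword
(with value `0` for the zero code, so `1 ≤ minDist C` forces `C ≠ ⊥`). -/
noncomputable def minDist (C : Code ι) : ℕ :=
  sInf {w | ∃ c ∈ C, c ≠ 0 ∧ hammingNorm c = w}

/-- Every coordinate `i` has a recovery set `R ∌ i` with `|R| ≤ r` and `c i = ∑ j ∈ R, c j`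
for all codewords `c`. -/
def HasLocality (C : Code ι) (r : ℕ) : Prop :=
  ∀ i, ∃ R : Finset ι, i ∉ R ∧ R.card ≤ r ∧ ∀ c ∈ C, c i = ∑ j ∈ R, c j

/-- The dual code. -/
def dual (C : Code ι) : Set (ι → ZMod 2) :=
  {w | ∀ c ∈ C, w ⬝ᵥ c = 0}

/-- `ℓ = n / (r + 1)` disjoint local repair groups: `ℓ` dual codewords of weight `r + 1` whose
supports are pairwise disjoint. -/
def HasDisjointRepairGroups (C : Code ι) (r ℓ : ℕ) : Prop :=
  Fintype.card ι = (r + 1) * ℓ ∧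
  ∃ h : Fin ℓ → ι → ZMod 2,
    (∀ i, h i ∈ dual C) ∧ (∀ i, hammingNorm (h i) = r + 1) ∧
    ∀ i j, i ≠ j → Disjoint (Function.support (h i)) (Function.support (h j))

/-- The explicit upper bound
`r n / (r + 1) - min {log₂ (1 + r n / 2), r n / ((r + 1) (r + 2))}`
for the dimension of a binary linear code of length `n`, locality `r` and minimum distance at
least `5`, valid for `2 ≤ r ≤ n / 2 - 2`. -/
noncomputable def dimBound (n r : ℕ) : ℝ :=
  (r : ℝ) * n / (r + 1) -
    min (Real.logb 2 (1 + (r : ℝ) * n / 2)) ((r : ℝ) * n / ((r + 1) * (r + 2)))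

/-- `C` is a `k`-optimal binary linear LRC with locality `r`: the parameters lie in the range of
the bound `dimBound`, and the dimension is the largest integer not exceeding that bound. -/
structure IsKOptimal (C : Code ι) (r : ℕ) : Prop where
  locality : HasLocality C r
  five_le_minDist : 5 ≤ minDist C
  two_le : 2 ≤ r
  le_half : (r : ℝ) ≤ (Fintype.card ι : ℝ) / 2 - 2
  finrank_eq : (Module.finrank (ZMod 2) C : ℤ) = ⌊dimBound (Fintype.card ι) r⌋

end Codes

/-- A partial `t`-spread `W₁, …, W_ℓ` of `𝔽₂ᵐ`: subspaces of dimension `t` with pairwise trivial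
intersection. -/
structure IsPartialSpread {m ℓ : ℕ} (t : ℕ) (W : Fin ℓ → Submodule (ZMod 2) (Fin m → ZMod 2)) :
    Prop where
  finrank_eq : ∀ i, Module.finrank (ZMod 2) (W i) = t
  inf_eq_bot : ∀ i j, i ≠ j → W i ⊓ W j = ⊥

/-- A desired matrix `A = (A₁ ; A₂)` of size `(s + t) × r`, with `A₁` the upper `s` rows and `A₂`
the lower `t` rows. -/
structure IsDesired {s t r : ℕ} (A : Matrix (Fin s ⊕ Fin t) (Fin r) (ZMod 2)) : Prop where
  lt_two_pow : r < 2 ^ t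
  lt : s < t
  rank_eq : A.rank = s + t
  two_columns : ∀ j j', j ≠ j' →
    LinearIndependent (ZMod 2) ![A.toRows₂.col j, A.toRows₂.col j']
  four_columns : 3 ≤ t → ∀ f : Fin 4 ↪ Fin r,
    LinearIndependent (ZMod 2) (fun i => A.col (f i))

section Construction

variable {s t m ℓ r : ℕ}

/-- The `m × t` matrix whose columns are the vectors of a basis of the subspace `W`. -/
noncomputable def basisMatrix {W : Submodule (ZMod 2) (Fin m → ZMod 2)}
    (e : Module.Basis (Fin t) (ZMod 2) W) : Matrix (Fin m) (Fin t) (ZMod 2) :=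
  Matrix.of fun p j => (e j : Fin m → ZMod 2) p

/-- The block-diagonal matrix `G_M = diag(G_U, G_W)` of size `(s + m) × (s + t)`. -/
def blockMatrix (GU : Matrix (Fin s) (Fin s) (ZMod 2)) (GW : Matrix (Fin m) (Fin t) (ZMod 2)) :
    Matrix (Fin s ⊕ Fin m) (Fin s ⊕ Fin t) (ZMod 2) :=
  Matrix.fromBlocks GU 0 0 GW

/-- The matrix `H_G = (0, G_M * A)` of size `(s + m) × (r + 1)`; column `0` is zero. -/
def lowerBlock (GM : Matrix (Fin s ⊕ Fin m) (Fin s ⊕ Fin t) (ZMod 2))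
    (A : Matrix (Fin s ⊕ Fin t) (Fin r) (ZMod 2)) :
    Matrix (Fin s ⊕ Fin m) (Fin (r + 1)) (ZMod 2) :=
  Matrix.of fun p => Fin.cons 0 fun j => (GM * A) p j

/-- The parity check matrix made of `ℓ` column blocks of width `r + 1`; column `j` of block `i` is
indexed by `(i, j)`. The upper `ℓ` rows of block `i` have row `i` all-one and the others zero; the
lower rows of block `i` are `HG i`. -/
def parityCheck (HG : Fin ℓ → Matrix (Fin s ⊕ Fin m) (Fin (r + 1)) (ZMod 2)) :
    Matrix (Fin ℓ ⊕ (Fin s ⊕ Fin m)) (Fin ℓ × Fin (r + 1)) (ZMod 2) :=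
  Matrix.fromRows
    (Matrix.of fun i' c => if i' = c.1 then 1 else 0)
    (Matrix.of fun p c => HG c.1 p c.2)

/-- The binary code with the parity check matrix assembled from `G_U`, from bases `e i` of the
members `W i` of a partial spread, and from `A`. -/
noncomputable def spreadCode (GU : Matrix (Fin s) (Fin s) (ZMod 2))
    {W : Fin ℓ → Submodule (ZMod 2) (Fin m → ZMod 2)}
    (e : ∀ i, Module.Basis (Fin t) (ZMod 2) (W i))
    (A : Matrix (Fin s ⊕ Fin t) (Fin r) (ZMod 2)) : Code (Fin ℓ × Fin (r + 1)) :=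
  LinearMap.ker
    (parityCheck fun i => lowerBlock (blockMatrix GU (basisMatrix (e i))) A).mulVecLin

end Construction

end BinaryLRC

/-!
Every block of a codeword has even weight, so a codeword of weight less than six meets at most two
blocks. A single block of weight at most four is excluded by the independence of any four columns of
`A`. For two blocks, one of weight two, the lower syndromes cancel and hence lie in
`W i ⊓ W j = ⊥`, which is excluded by the independence of any two columns of `A₂`.

The members of the spread have too many nonzero vectors for a hyperplane, so they span `𝔽₂ᵐ` and the
parity check matrix has full rank `ℓ + m + s`. With `k = m + s`, the two bounds on `ℓ` say that
`2 ^ k < 2 + r (r + 1) ℓ ≤ 2 ^ (k + 1)`. This places the logarithm in `dimBound` in `(k - 1, k]`,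
while the other term of the minimum is at least `k`, so the floor is `r ℓ - k`.

The spread itself comes from writing `𝔽₂ᵐ` as `𝔽₂ᵗ × 𝔽_q` with `q = 2 ^ (m - t)`: the graphs of
`x ↦ a * g x`, for `a : 𝔽_q` and a fixed injective linear `g`, meet pairwise trivially, and a spread
of `𝔽_q` can be added to them.
-/

namespace BinaryLRC

section PartialSpread

variable {F V : Type*} [Field F] [AddCommGroup V] [Module F V]

/-- `V` has a partial `t`-spread of size `N`: subspaces `W₁, …, W_N` of dimension `t` with pairwise
trivial intersection. For `V = 𝔽₂ᵐ` such a family is an `IsPartialSpread`; arbitrary `F` and `V`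
are needed because the inductive construction passes through field extensions and products. -/
def HasPartialSpread (F V : Type*) [Field F] [AddCommGroup V] [Module F V] (t N : ℕ) : Prop :=
  ∃ W : Fin N → Submodule F V,
    (∀ i, Module.finrank F (W i) = t) ∧ Pairwise fun i j => Disjoint (W i) (W j)

lemma HasPartialSpread.of_finite {ι : Type*} [Finite ι] {t : ℕ} {W : ι → Submodule F V}
    (hW : ∀ i, Module.finrank F (W i) = t) (hd : Pairwise fun i j => Disjoint (W i) (W j)) :
    HasPartialSpread F V t (Nat.card ι) :=
  ⟨fun k => W ((Finite.equivFin ι).symm k), fun _ => hW _,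
    fun _ _ hij => hd ((Finite.equivFin ι).symm.injective.ne hij)⟩

lemma HasPartialSpread.mono {t N N' : ℕ} (h : HasPartialSpread F V t N) (hN : N' ≤ N) :
    HasPartialSpread F V t N' := by
  obtain ⟨W, hW, hd⟩ := h
  exact ⟨fun i => W (Fin.castLE hN i), fun i => hW _,
    fun i j hij => hd ((Fin.castLE_injective hN).ne hij)⟩

lemma HasPartialSpread.congr {U : Type*} [AddCommGroup U] [Module F U] {t N : ℕ}
    (h : HasPartialSpread F V t N) (f : V ≃ₗ[F] U) : HasPartialSpread F U t N := by
  obtain ⟨W, hW, hd⟩ := h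
  exact ⟨fun i => (W i).map (f : V →ₗ[F] U),
    fun i => (f.submoduleMap (W i)).finrank_eq.symm.trans (hW i),
    fun i j hij => Submodule.disjoint_map f.injective (hd hij)⟩

lemma hasPartialSpread_one {t : ℕ} (ht : t ≤ Module.finrank F V) : HasPartialSpread F V t 1 := by
  obtain ⟨f, hf⟩ := exists_linearIndependent_of_le_finrank ht
  exact ⟨fun _ => Submodule.span F (Set.range f),
    fun _ => by rw [finrank_span_eq_card hf, Fintype.card_fin],
    fun i j hij => (hij (Subsingleton.elim i j)).elim⟩

variable {U : Type*} [AddCommGroup U] [Module F U]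

lemma finrank_graph (φ : U →ₗ[F] V) : Module.finrank F φ.graph = Module.finrank F U := by
  rw [LinearMap.graph_eq_range_prod]
  exact LinearMap.finrank_range_of_inj fun _ _ h => congrArg Prod.fst h

lemma disjoint_graph_graph {φ ψ : U →ₗ[F] V} (h : Function.Injective (φ - ψ)) :
    Disjoint φ.graph ψ.graph := by
  rw [Submodule.disjoint_def]
  rintro ⟨x, y⟩ hφ hψ
  rw [LinearMap.mem_graph_iff] at hφ hψ
  dsimp only at hφ hψ
  have hx : x = 0 := (map_eq_zero_iff _ h).1 (by rw [LinearMap.sub_apply, ← hφ, ← hψ, sub_self])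
  rw [hφ, hx, map_zero, Prod.mk_zero_zero]

lemma disjoint_graph_map_inr (φ : U →ₗ[F] V) (W : Submodule F V) :
    Disjoint φ.graph (W.map (LinearMap.inr F U V)) := by
  rw [Submodule.disjoint_def]
  rintro _ hφ ⟨y, -, rfl⟩
  have hy : y = 0 := by simpa using (LinearMap.mem_graph_iff _ _).1 hφ
  rw [hy, map_zero]

lemma HasPartialSpread.prod {ι : Type*} [Finite ι] {N : ℕ}
    (h : HasPartialSpread F V (Module.finrank F U) N) (φ : ι → U →ₗ[F] V)
    (hφ : Pairwise fun a b => Function.Injective (φ a - φ b)) :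
    HasPartialSpread F (U × V) (Module.finrank F U) (Nat.card ι + N) := by
  obtain ⟨W, hW, hd⟩ := h
  rw [← Nat.card_fin N, ← Nat.card_sum]
  refine .of_finite (W := Sum.elim (fun a => (φ a).graph)
    fun i => (W i).map (LinearMap.inr F U V)) ?_ ?_
  · rintro (a | i)
    · exact finrank_graph (φ a)
    · exact ((W i).equivMapOfInjective _ LinearMap.inr_injective).finrank_eq.symm.trans (hW i)
  · rintro (a | i) (b | j) hne
    · exact disjoint_graph_graph (hφ fun hab => hne (congrArg Sum.inl hab))
    · exact disjoint_graph_map_inr (φ a) (W j)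
    · exact (disjoint_graph_map_inr (φ b) (W i)).symm
    · exact Submodule.disjoint_map LinearMap.inr_injective
        (hd fun hij => hne (congrArg Sum.inr hij))

/-- The multiplications `x ↦ a * g x` by the elements `a` of `K`, restricted along an embedding
`g` of `Fᵗ` into `K`, have injective pairwise differences because `K` has no zero divisors. -/
lemma HasPartialSpread.prod_field {K : Type*} [Field K] [Algebra F K] [Finite K] {t N : ℕ}
    (h : HasPartialSpread F K t N) (ht : t ≤ Module.finrank F K) :
    HasPartialSpread F ((Fin t → F) × K) t (Nat.card K + N) := by
  obtain ⟨f, hf⟩ := exists_linearIndependent_of_le_finrank ht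
  have hg : Function.Injective (Fintype.linearCombination F f) :=
    linearIndependent_iff_injective_fintypeLinearCombination.1 hf
  have hfr : Module.finrank F (Fin t → F) = t := Module.finrank_fin_fun F
  rw [← hfr] at h
  convert h.prod (fun a : K => LinearMap.mulLeft F a ∘ₗ Fintype.linearCombination F f)
    fun a b hab => ?_
  · exact hfr.symm
  · have hmul := mul_right_injective₀ (sub_ne_zero.2 hab)
    intro x y hxy
    refine hg (hmul ?_)
    simpa only [LinearMap.sub_apply, LinearMap.comp_apply, LinearMap.mulLeft_apply,
      ← sub_mul] using hxy

/-- The counting identity says `N = (qᵐ - qᵗ (qᶻ - 1) - 1) / (qᵗ - 1)` with `q = |F|` and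
`m = k t + z`, freed of subtraction and division. -/
lemma exists_hasPartialSpread (F : Type*) [Field F] [Finite F] {t k : ℕ} (z : ℕ) (ht : 0 < t)
    (hk : 1 ≤ k) :
    ∃ N : ℕ, N * Nat.card F ^ t + Nat.card F ^ t * Nat.card F ^ z + 1 =
        Nat.card F ^ (k * t + z) + Nat.card F ^ t + N ∧
      HasPartialSpread F (Fin (k * t + z) → F) t N := by
  induction k, hk using Nat.le_induction with
  | base =>
    exact ⟨1, by ring, hasPartialSpread_one (by simp)⟩
  | succ k hk ih =>
    obtain ⟨N, hN, hspread⟩ := ih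
    set n := k * t + z with hn
    have htn : t ≤ n := (Nat.le_mul_of_pos_left t hk).trans (Nat.le_add_right _ z)
    have hsucc : (k + 1) * t + z = t + n := by rw [hn]; ring
    have : NeZero n := ⟨by omega⟩
    obtain ⟨p, hchar⟩ := CharP.exists F
    have : Fact p.Prime := ⟨CharP.char_is_prime F p⟩
    let K := FiniteField.Extension F p n
    have hK : Module.finrank F K = n := FiniteField.finrank_extension F p n
    have hspreadK : HasPartialSpread F K t N :=
      hspread.congr (LinearEquiv.ofFinrankEq _ _ (by rw [hK, Module.finrank_fin_fun]))
    refine ⟨Nat.card K + N, ?_, (hspreadK.prod_field (htn.trans_eq hK.symm)).congr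
      (LinearEquiv.ofFinrankEq _ _ ?_)⟩
    · rw [FiniteField.natCard_extension, hsucc, pow_add _ t n]
      linarith
    · rw [Module.finrank_prod, hK, Module.finrank_fin_fun, Module.finrank_fin_fun, hsucc]

lemma card_mul_lt_of_pairwise_disjoint [Finite F] [Finite V] {ι : Type*} [Fintype ι] {t : ℕ}
    {W : ι → Submodule F V} {U : Submodule F V} (hW : ∀ i, Module.finrank F (W i) = t)
    (hd : Pairwise fun i j => Disjoint (W i) (W j)) (hU : ∀ i, W i ≤ U) :
    Fintype.card ι * (Nat.card F ^ t - 1) < Nat.card F ^ Module.finrank F U := by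
  have hcard (X : Submodule F V) :
      ((X : Set V) \ {0}).ncard = Nat.card F ^ Module.finrank F X - 1 := by
    rw [Set.ncard_sdiff_singleton_of_mem X.zero_mem, ← Module.natCard_eq_pow_finrank]
    rfl
  have hdisj : Pairwise (Function.onFun Disjoint fun i => (W i : Set V) \ {0}) := by
    refine fun i j hij => Set.disjoint_left.2 fun v hi hj => hi.2 ?_
    exact Submodule.disjoint_def.1 (hd hij) v hi.1 hj.1
  have hunion : (⋃ i, (W i : Set V) \ {0}).ncard = Fintype.card ι * (Nat.card F ^ t - 1) := by
    rw [Set.ncard_iUnion_of_finite (fun _ => Set.toFinite _) hdisj, finsum_eq_sum_of_fintype]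
    simp only [hcard, hW, Finset.sum_const, Finset.card_univ, smul_eq_mul]
  have hle : (⋃ i, (W i : Set V) \ {0}).ncard ≤ ((U : Set V) \ {0}).ncard :=
    Set.ncard_le_ncard (Set.iUnion_subset fun i => Set.sdiff_subset_sdiff_left (hU i))
  rw [hunion, hcard] at hle
  have hpos : 0 < Nat.card F ^ Module.finrank F U := Nat.pow_pos Nat.card_pos
  omega

lemma iSup_eq_top_of_pairwise_disjoint [Finite F] [Finite V] {ι : Type*} [Fintype ι] {t : ℕ}
    {W : ι → Submodule F V} (hW : ∀ i, Module.finrank F (W i) = t)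
    (hd : Pairwise fun i j => Disjoint (W i) (W j))
    (hcard : Nat.card F ^ (Module.finrank F V - 1) ≤ Fintype.card ι * (Nat.card F ^ t - 1)) :
    ⨆ i, W i = ⊤ := by
  by_contra hne
  have hlt : Module.finrank F ↥(⨆ i, W i) < Module.finrank F V := Submodule.finrank_lt hne
  have hpow : Nat.card F ^ Module.finrank F ↥(⨆ i, W i) ≤ Nat.card F ^ (Module.finrank F V - 1) :=
    Nat.pow_le_pow_right Nat.card_pos (Nat.le_sub_one_of_lt hlt)
  exact absurd (card_mul_lt_of_pairwise_disjoint hW hd (le_iSup W)) (hpow.trans hcard).not_gt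

end PartialSpread

section Weight

variable {ι κ : Type*} [Fintype ι] [Fintype κ]

lemma natCast_hammingNorm (x : ι → ZMod 2) : (hammingNorm x : ZMod 2) = ∑ i, x i := by
  have hite (a : ZMod 2) : (if a ≠ 0 then 1 else 0) = a := by revert a; decide
  rw [hammingNorm, ← Finset.sum_boole]
  exact Finset.sum_congr rfl fun i _ => hite (x i)

lemma even_hammingNorm {x : ι → ZMod 2} (h : ∑ i, x i = 0) : Even (hammingNorm x) := by
  rwa [← ZMod.natCast_eq_zero_iff_even, natCast_hammingNorm]

lemma hammingNorm_prod {M : Type*} [Zero M] [DecidableEq M] (c : ι × κ → M) :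
    hammingNorm c = ∑ i, hammingNorm (Function.curry c i) := by
  simp only [hammingNorm, Finset.card_filter, Fintype.sum_prod_type]
  rfl

lemma hammingNorm_comp_injective_le {M : Type*} [Zero M] [DecidableEq M] (x : κ → M) {f : ι → κ}
    (hf : Function.Injective f) : hammingNorm (x ∘ f) ≤ hammingNorm x :=
  Finset.card_le_card_of_injOn f (fun i hi => by simpa using hi) hf.injOn

lemma eq_zero_of_sum_eq_zero_of_tail_eq_zero {M : Type*} [AddCommMonoid M] {n : ℕ}
    {x : Fin (n + 1) → M} (hsum : ∑ j, x j = 0) (htail : Fin.tail x = 0) : x = 0 := by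
  have hsucc (j : Fin n) : x j.succ = 0 := congrFun htail j
  have hzero : x 0 = 0 := by simpa [Fin.sum_univ_succ, hsucc] using hsum
  exact funext (Fin.cases hzero hsucc)

lemma eq_zero_of_mulVec_eq_zero_of_hammingNorm_le {R ρ : Type*} [CommRing R] [DecidableEq R]
    {M : Matrix ρ κ R} {k : ℕ} (hk : k ≤ Fintype.card κ)
    (hM : ∀ f : Fin k ↪ κ, LinearIndependent R fun i => M.col (f i))
    {y : κ → R} (hy : hammingNorm y ≤ k) (hMy : M.mulVec y = 0) : y = 0 := by
  obtain ⟨S, hyS, -, hS⟩ := Finset.exists_subsuperset_card_eq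
    (Finset.subset_univ {j | y j ≠ 0}) hy (by simpa using hk)
  have hout (j) (hj : j ∉ S) : y j = 0 := by
    by_contra h
    exact hj (hyS (by simpa using h))
  let f : Fin k ≃ S := (S.equivFinOfCardEq hS).symm
  have hsum : ∑ i, y (f i) • M.col (f i) = 0 := by
    rw [Equiv.sum_comp f fun j : S => y j • M.col j, Finset.sum_coe_sort S fun j => y j • M.col j,
      Finset.sum_subset (Finset.subset_univ S) fun j _ hj => by rw [hout j hj, zero_smul],
      ← hMy, Matrix.mulVec_eq_sum]
    simp only [op_smul_eq_smul, Matrix.col]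
  have hli := hM (f.toEmbedding.trans (Function.Embedding.subtype _))
  have hin := Fintype.linearIndependent_iff.1 hli (fun i => y (f i)) hsum
  funext j
  by_cases hj : j ∈ S
  · simpa using hin (f.symm ⟨j, hj⟩)
  · exact hout j hj

lemma le_minDist {C : Code ι} {d : ℕ} (hC : C ≠ ⊥) (h : ∀ c ∈ C, hammingNorm c < d → c = 0) :
    d ≤ minDist C := by
  obtain ⟨c, hc, hc0⟩ := Submodule.exists_mem_ne_zero_of_ne_bot hC
  refine le_csInf ⟨_, c, hc, hc0, rfl⟩ ?_
  rintro _ ⟨x, hx, hx0, rfl⟩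
  exact not_lt.1 fun hlt => hx0 (h x hx hlt)

lemma eq_zero_or_eq_two_of_even_of_sum_lt_six {w : ι → ℕ} (heven : ∀ i, Even (w i))
    (hsum : ∑ i, w i < 6) {i : ι} (hi : w i ≠ 0) :
    (w i ≤ 4 ∧ ∀ k ≠ i, w k = 0) ∨
      ∃ j ≠ i, w i = 2 ∧ ∀ k, k ≠ i ∧ k ≠ j → w k = 0 := by
  classical
  have htwo {k} (hk : w k ≠ 0) : 2 ≤ w k := by
    obtain ⟨a, ha⟩ := heven k
    omega
  have hsub (S : Finset ι) : ∑ k ∈ S, w k < 6 :=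
    (Finset.sum_le_sum_of_subset (Finset.subset_univ S)).trans_lt hsum
  obtain ⟨a, ha⟩ := heven i
  by_cases hother : ∃ j ≠ i, w j ≠ 0
  · obtain ⟨j, hji, hj⟩ := hother
    have hpair := hsub {i, j}
    rw [Finset.sum_pair hji.symm] at hpair
    refine Or.inr ⟨j, hji, by have := htwo hi; have := htwo hj; omega, fun k hk => ?_⟩
    by_contra hk0
    have htriple := hsub {i, j, k}
    rw [Finset.sum_insert (by simp [hji.symm, hk.1.symm]), Finset.sum_pair hk.2.symm] at htriple
    linarith [htwo hi, htwo hj, htwo hk0]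
  · push Not at hother
    have hsingle := hsub {i}
    rw [Finset.sum_singleton] at hsingle
    exact Or.inl ⟨by omega, hother⟩

lemma HasDisjointRepairGroups.hasLocality {C : Code ι} {r ℓ : ℕ}
    (h : HasDisjointRepairGroups C r ℓ) : HasLocality C r := by
  classical
  obtain ⟨hn, w, hdual, hweight, hdisj⟩ := h
  have hcover : (Finset.univ.biUnion fun k => ({i | w k i ≠ 0} : Finset ι)) = Finset.univ := by
    rw [← Finset.card_eq_iff_eq_univ, Finset.card_biUnion]
    · exact (Finset.sum_congr rfl fun k _ => hweight k).trans (by simp [hn, mul_comm])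
    · intro k _ l _ hkl
      rw [Function.onFun, Finset.disjoint_left]
      simpa [Set.disjoint_left] using hdisj k l hkl
  intro i
  obtain ⟨k, hk⟩ : ∃ k, w k i ≠ 0 := by
    simpa using hcover.ge (Finset.mem_univ i)
  refine ⟨({j | w k j ≠ 0} : Finset ι).erase i, Finset.notMem_erase _ _, ?_, fun c hc => ?_⟩
  · rw [Finset.card_erase_of_mem (by simpa using hk)]
    exact (congrArg (· - 1) (hweight k)).le
  · have hite (a b : ZMod 2) : a * b = if a ≠ 0 then b else 0 := by revert a b; decide
    have hsum : ∑ j with w k j ≠ 0, c j = 0 := by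
      rw [Finset.sum_filter, Finset.sum_congr rfl fun j _ => (hite (w k j) (c j)).symm]
      exact hdual k c hc
    rw [← Finset.add_sum_erase _ _ (show i ∈ _ by simpa using hk)] at hsum
    exact CharTwo.add_eq_zero.1 hsum

end Weight

section SpreadCode

open Matrix

lemma mulVec_surjective_of_rank_eq_card {K ρ κ : Type*} [Field K] [Fintype ρ] [Fintype κ]
    {M : Matrix ρ κ K} (h : M.rank = Fintype.card ρ) : Function.Surjective M.mulVec := by
  have hrange : LinearMap.range M.mulVecLin = ⊤ :=
    Submodule.eq_top_of_finrank_eq (h.trans (Module.finrank_fintype_fun_eq_card K).symm)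
  exact LinearMap.range_eq_top.1 hrange

variable {s t m ℓ r : ℕ} {GU : Matrix (Fin s) (Fin s) (ZMod 2)}
  {W : Fin ℓ → Submodule (ZMod 2) (Fin m → ZMod 2)}
  {e : ∀ i, Module.Basis (Fin t) (ZMod 2) (W i)}
  {A : Matrix (Fin s ⊕ Fin t) (Fin r) (ZMod 2)}

lemma IsPartialSpread.pairwise_disjoint (hW : IsPartialSpread t W) :
    Pairwise fun i j => Disjoint (W i) (W j) :=
  fun i j hij => disjoint_iff.2 (hW.inf_eq_bot i j hij)

lemma IsPartialSpread.iSup_eq_top (hW : IsPartialSpread t W)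
    (h : 2 ^ (m - 1) ≤ ℓ * (2 ^ t - 1)) : ⨆ i, W i = ⊤ :=
  iSup_eq_top_of_pairwise_disjoint hW.finrank_eq hW.pairwise_disjoint (by simpa using h)

lemma parityCheck_mulVec_inl (HG : Fin ℓ → Matrix (Fin s ⊕ Fin m) (Fin (r + 1)) (ZMod 2))
    (c : Fin ℓ × Fin (r + 1) → ZMod 2) (i : Fin ℓ) :
    (parityCheck HG *ᵥ c) (Sum.inl i) = ∑ j, c (i, j) := by
  simp only [mulVec, dotProduct, Fintype.sum_prod_type]
  rw [Fintype.sum_eq_single i fun k hk => by simp [parityCheck, hk.symm]]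
  simp [parityCheck]

lemma parityCheck_lowerBlock_mulVec_inr
    (GM : Fin ℓ → Matrix (Fin s ⊕ Fin m) (Fin s ⊕ Fin t) (ZMod 2))
    (A : Matrix (Fin s ⊕ Fin t) (Fin r) (ZMod 2)) (c : Fin ℓ × Fin (r + 1) → ZMod 2)
    (p : Fin s ⊕ Fin m) :
    ((parityCheck fun i => lowerBlock (GM i) A) *ᵥ c) (Sum.inr p) =
      (∑ i, GM i *ᵥ A *ᵥ Fin.tail (Function.curry c i)) p := by
  simp only [mulVec_mulVec, Finset.sum_apply]
  simp [parityCheck, lowerBlock, mulVec, dotProduct, Fintype.sum_prod_type, Fin.sum_univ_succ,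
    Fin.tail]

lemma mem_spreadCode {c : Fin ℓ × Fin (r + 1) → ZMod 2} :
    c ∈ spreadCode GU e A ↔ (∀ i, ∑ j, c (i, j) = 0) ∧
      ∑ i, blockMatrix GU (basisMatrix (e i)) *ᵥ A *ᵥ Fin.tail (Function.curry c i) = 0 := by
  rw [spreadCode, LinearMap.mem_ker, mulVecLin_apply, funext_iff, Sum.forall]
  simp only [parityCheck_mulVec_inl, parityCheck_lowerBlock_mulVec_inr, Pi.zero_apply]
  rw [funext_iff]
  rfl

lemma basisMatrix_mulVec {U : Submodule (ZMod 2) (Fin m → ZMod 2)}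
    (f : Module.Basis (Fin t) (ZMod 2) U) (q : Fin t → ZMod 2) :
    basisMatrix f *ᵥ q = (f.equivFun.symm q : Fin m → ZMod 2) := by
  funext p
  simp [basisMatrix, mulVec, dotProduct, Module.Basis.equivFun_symm_apply, mul_comm]

lemma basisMatrix_mulVec_mem {U : Submodule (ZMod 2) (Fin m → ZMod 2)}
    (f : Module.Basis (Fin t) (ZMod 2) U) (q : Fin t → ZMod 2) : basisMatrix f *ᵥ q ∈ U :=
  basisMatrix_mulVec f q ▸ Subtype.mem _

lemma basisMatrix_mulVec_injective {U : Submodule (ZMod 2) (Fin m → ZMod 2)}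
    (f : Module.Basis (Fin t) (ZMod 2) U) : Function.Injective (basisMatrix f).mulVec := by
  intro q q' h
  rw [basisMatrix_mulVec, basisMatrix_mulVec] at h
  exact f.equivFun.symm.injective (Subtype.ext h)

lemma blockMatrix_mulVec (GU : Matrix (Fin s) (Fin s) (ZMod 2))
    (GW : Matrix (Fin m) (Fin t) (ZMod 2)) (x : Fin s ⊕ Fin t → ZMod 2) :
    blockMatrix GU GW *ᵥ x = Sum.elim (GU *ᵥ (x ∘ Sum.inl)) (GW *ᵥ (x ∘ Sum.inr)) := by
  simp [blockMatrix, fromBlocks_mulVec]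

lemma blockMatrix_mulVec_injective {GW : Matrix (Fin m) (Fin t) (ZMod 2)}
    (hGU : Function.Injective GU.mulVec) (hGW : Function.Injective GW.mulVec) :
    Function.Injective (blockMatrix GU GW).mulVec := by
  intro x x' h
  rw [blockMatrix_mulVec, blockMatrix_mulVec, Sum.elim_eq_iff] at h
  rw [← Sum.elim_comp_inl_inr x, hGU h.1, hGW h.2, Sum.elim_comp_inl_inr]

lemma IsDesired.eq_zero_of_hammingNorm_le_four (hA : IsDesired A) (ht : 3 ≤ t) (hr : 4 ≤ r)
    {y : Fin r → ZMod 2} (hy : hammingNorm y ≤ 4) (h : A *ᵥ y = 0) : y = 0 :=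
  eq_zero_of_mulVec_eq_zero_of_hammingNorm_le (by simpa using hr) (hA.four_columns ht) hy h

lemma IsDesired.eq_zero_of_hammingNorm_le_two (hA : IsDesired A) (hr : 2 ≤ r)
    {y : Fin r → ZMod 2} (hy : hammingNorm y ≤ 2) (h : A.toRows₂ *ᵥ y = 0) : y = 0 := by
  refine eq_zero_of_mulVec_eq_zero_of_hammingNorm_le (by simpa using hr) (fun f => ?_) hy h
  have hcols : (fun i => A.toRows₂.col (f i)) = ![A.toRows₂.col (f 0), A.toRows₂.col (f 1)] := by
    funext i
    fin_cases i <;> rfl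
  exact hcols ▸ hA.two_columns (f 0) (f 1) (f.injective.ne Fin.zero_ne_one)

lemma toRows₂_mulVec_eq_zero_of_blockMatrix_mulVec_add {U U' : Submodule (ZMod 2) (Fin m → ZMod 2)}
    (hU : Disjoint U U') (f : Module.Basis (Fin t) (ZMod 2) U)
    (f' : Module.Basis (Fin t) (ZMod 2) U') {y y' : Fin r → ZMod 2}
    (h : blockMatrix GU (basisMatrix f) *ᵥ A *ᵥ y +
      blockMatrix GU (basisMatrix f') *ᵥ A *ᵥ y' = 0) :
    A.toRows₂ *ᵥ y = 0 := by
  have hlower : basisMatrix f *ᵥ A.toRows₂ *ᵥ y = basisMatrix f' *ᵥ A.toRows₂ *ᵥ y' := by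
    rw [blockMatrix_mulVec, blockMatrix_mulVec] at h
    exact funext fun p => CharTwo.add_eq_zero.1 (congrFun h (Sum.inr p))
  have hzero : basisMatrix f *ᵥ A.toRows₂ *ᵥ y = 0 :=
    Submodule.disjoint_def.1 hU _ (basisMatrix_mulVec_mem f _)
      (hlower ▸ basisMatrix_mulVec_mem f' _)
  exact basisMatrix_mulVec_injective f (hzero.trans (mulVec_zero _).symm)

lemma eq_zero_of_mem_spreadCode (hA : IsDesired A) (ht : 3 ≤ t) (hr : 4 ≤ r)
    (hW : IsPartialSpread t W) (hGU : LinearIndependent (ZMod 2) GU.col)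
    {c : Fin ℓ × Fin (r + 1) → ZMod 2} (hc : c ∈ spreadCode GU e A) (hweight : hammingNorm c < 6) :
    c = 0 := by
  obtain ⟨hsum, hsyndrome⟩ := mem_spreadCode.1 hc
  rw [hammingNorm_prod] at hweight
  suffices hblock : ∀ i, Function.curry c i = 0 from funext fun p => congrFun (hblock p.1) p.2
  intro i
  by_contra hi
  have htail : Fin.tail (Function.curry c i) ≠ 0 := fun h =>
    hi (eq_zero_of_sum_eq_zero_of_tail_eq_zero (hsum i) h)
  have htail_le : hammingNorm (Fin.tail (Function.curry c i)) ≤ hammingNorm (Function.curry c i) :=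
    hammingNorm_comp_injective_le _ (Fin.succ_injective r)
  have hvanish {k : Fin ℓ} (hk : hammingNorm (Function.curry c k) = 0) :
      blockMatrix GU (basisMatrix (e k)) *ᵥ A *ᵥ Fin.tail (Function.curry c k) = 0 := by
    rw [hammingNorm_eq_zero.1 hk, show Fin.tail (0 : Fin (r + 1) → ZMod 2) = 0 from rfl,
      mulVec_zero, mulVec_zero]
  rcases eq_zero_or_eq_two_of_even_of_sum_lt_six (fun k => even_hammingNorm (hsum k)) hweight
    (hammingNorm_ne_zero_iff.2 hi) with ⟨hfour, hother⟩ | ⟨j, hji, htwo, hother⟩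
  · rw [Fintype.sum_eq_single i fun k hk => hvanish (hother k hk)] at hsyndrome
    have hinj := blockMatrix_mulVec_injective (mulVec_injective_iff.2 hGU)
      (basisMatrix_mulVec_injective (e i))
    exact htail (hA.eq_zero_of_hammingNorm_le_four ht hr (htail_le.trans hfour)
      (hinj (hsyndrome.trans (mulVec_zero _).symm)))
  · rw [Fintype.sum_eq_add i j hji.symm fun k hk => hvanish (hother k hk)] at hsyndrome
    exact htail (hA.eq_zero_of_hammingNorm_le_two (by omega) (htail_le.trans htwo.le)
      (toRows₂_mulVec_eq_zero_of_blockMatrix_mulVec_add (hW.pairwise_disjoint hji.symm) (e i) (e j)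
        hsyndrome))

lemma hasDisjointRepairGroups_spreadCode : HasDisjointRepairGroups (spreadCode GU e A) r ℓ := by
  refine ⟨by simp [mul_comm], fun i p => if p.1 = i then 1 else 0, fun i c hc => ?_, fun i => ?_,
    fun i j hij => ?_⟩
  · refine Eq.trans ?_ ((mem_spreadCode.1 hc).1 i)
    simp only [dotProduct, Fintype.sum_prod_type]
    rw [Fintype.sum_eq_single i fun k hk => by simp [hk]]
    simp
  · rw [hammingNorm_prod,
      Fintype.sum_eq_single i fun k hk => by simp [hk, hammingNorm, Function.curry]]
    simp [hammingNorm, Function.curry]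
  · rw [Set.disjoint_left]
    intro p hp hq
    simp only [Function.mem_support, ne_eq, ite_eq_right_iff, one_ne_zero, imp_false,
      not_not] at hp hq
    exact hij (hp.symm.trans hq)

lemma exists_sum_basisMatrix_mulVec (e : ∀ i, Module.Basis (Fin t) (ZMod 2) (W i))
    (hW : ⨆ i, W i = ⊤) (v : Fin m → ZMod 2) :
    ∃ q : Fin ℓ → Fin t → ZMod 2, ∑ i, basisMatrix (e i) *ᵥ q i = v := by
  obtain ⟨f, hf, hsum⟩ := (Submodule.mem_iSup_iff_exists_finsupp W v).1 (hW ▸ Submodule.mem_top)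
  refine ⟨fun i => (e i).equivFun ⟨f i, hf i⟩, ?_⟩
  simp only [basisMatrix_mulVec, LinearEquiv.symm_apply_apply]
  rwa [Finsupp.sum_fintype _ _ fun _ => rfl] at hsum

lemma exists_sum_blockMatrix_mulVec (e : ∀ i, Module.Basis (Fin t) (ZMod 2) (W i))
    (hW : ⨆ i, W i = ⊤) (hℓ : 0 < ℓ) (hGU : Function.Surjective GU.mulVec)
    (v : Fin s ⊕ Fin m → ZMod 2) :
    ∃ x : Fin ℓ → Fin s ⊕ Fin t → ZMod 2,
      ∑ i, blockMatrix GU (basisMatrix (e i)) *ᵥ x i = v := by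
  obtain ⟨q, hq⟩ := exists_sum_basisMatrix_mulVec e hW (v ∘ Sum.inr)
  obtain ⟨u, hu⟩ := hGU (v ∘ Sum.inl)
  let i₀ : Fin ℓ := ⟨0, hℓ⟩
  refine ⟨fun i => Sum.elim (if i = i₀ then u else 0) (q i), ?_⟩
  simp only [blockMatrix_mulVec, Sum.elim_comp_inl, Sum.elim_comp_inr]
  funext p
  rcases p with p | p
  · rw [Finset.sum_apply, Fintype.sum_eq_single i₀ fun k hk => by simp [hk]]
    simpa using congrFun hu p
  · simpa using congrFun hq p

lemma parityCheck_mulVec_surjective {GM : Fin ℓ → Matrix (Fin s ⊕ Fin m) (Fin s ⊕ Fin t) (ZMod 2)}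
    (hA : Function.Surjective A.mulVec)
    (hGM : ∀ v, ∃ x : Fin ℓ → Fin s ⊕ Fin t → ZMod 2, ∑ i, GM i *ᵥ x i = v) :
    Function.Surjective (parityCheck fun i => lowerBlock (GM i) A).mulVec := by
  intro v
  obtain ⟨x, hx⟩ := hGM (v ∘ Sum.inr)
  choose y hy using fun i => hA (x i)
  refine ⟨Function.uncurry fun i => Fin.cons (v (Sum.inl i) - ∑ j, y i j) (y i), ?_⟩
  funext p
  rcases p with i | p
  · simp [parityCheck_mulVec_inl, Fin.sum_univ_succ]
  · simpa [parityCheck_lowerBlock_mulVec_inr, hy] using congrFun hx p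

lemma finrank_spreadCode (hA : A.rank = s + t) (hW : ⨆ i, W i = ⊤) (hℓ : 0 < ℓ)
    (hGU : LinearIndependent (ZMod 2) GU.col) :
    Module.finrank (ZMod 2) (spreadCode GU e A) + (ℓ + (s + m)) = ℓ * (r + 1) := by
  have hGU_surj : Function.Surjective GU.mulVec :=
    mulVec_surjective_iff_isUnit.2 (mulVec_injective_iff_isUnit.1 (mulVec_injective_iff.2 hGU))
  have hsurj := parityCheck_mulVec_surjective
    (mulVec_surjective_of_rank_eq_card (by simpa using hA))
    (exists_sum_blockMatrix_mulVec e hW hℓ hGU_surj)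
  have hrank := LinearMap.finrank_range_add_finrank_ker
    (parityCheck fun i => lowerBlock (blockMatrix GU (basisMatrix (e i))) A).mulVecLin
  rw [LinearMap.range_eq_top.2 hsurj, finrank_top] at hrank
  simp only [Module.finrank_fintype_fun_eq_card, Fintype.card_sum, Fintype.card_prod,
    Fintype.card_fin] at hrank
  rw [spreadCode]
  omega

end SpreadCode

section DimensionBound

lemma dimBound_mul_succ (ℓ r : ℕ) :
    dimBound (ℓ * (r + 1)) r =
      r * ℓ - min (Real.logb 2 ((2 + r * (r + 1) * ℓ) / 2)) (r * ℓ / (r + 2)) := by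
  have hfirst : (r : ℝ) * (ℓ * (r + 1)) / (r + 1) = r * ℓ := by field_simp
  have hlog : 1 + (r : ℝ) * (ℓ * (r + 1)) / 2 = (2 + r * (r + 1) * ℓ) / 2 := by ring
  have hlast : (r : ℝ) * (ℓ * (r + 1)) / ((r + 1) * (r + 2)) = r * ℓ / (r + 2) := by field_simp
  rw [dimBound]
  push_cast
  rw [hfirst, hlog, hlast]

lemma floor_dimBound {r ℓ k : ℕ} (hlow : 2 ^ k < 2 + r * (r + 1) * ℓ)
    (hup : 2 + r * (r + 1) * ℓ ≤ 2 ^ (k + 1)) (hk : k * (r + 2) ≤ r * ℓ) :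
    ⌊dimBound (ℓ * (r + 1)) r⌋ = (r * ℓ : ℤ) - k := by
  set x : ℝ := 2 + r * (r + 1) * ℓ with hx
  have hx_pos : 0 < x := by positivity
  have hlow' : (k : ℝ) < Real.logb 2 x := by
    rw [Real.lt_logb_iff_rpow_lt one_lt_two hx_pos, Real.rpow_natCast, hx]
    exact_mod_cast hlow
  have hup' : Real.logb 2 x ≤ (k + 1 : ℕ) := by
    rw [Real.logb_le_iff_le_rpow one_lt_two hx_pos, Real.rpow_natCast, hx]
    exact_mod_cast hup
  have hk' : (k : ℝ) ≤ r * ℓ / (r + 2) := by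
    rw [le_div_iff₀ (by positivity)]
    exact_mod_cast hk
  have hlog : Real.logb 2 (x / 2) = Real.logb 2 x - 1 := by
    rw [Real.logb_div hx_pos.ne' two_ne_zero, Real.logb_self_eq_one one_lt_two]
  have hmin_lt : (k : ℝ) - 1 < min (Real.logb 2 (x / 2)) (r * ℓ / (r + 2)) :=
    lt_min (by linarith) (by linarith)
  have hmin_le : min (Real.logb 2 (x / 2)) (r * ℓ / (r + 2)) ≤ k :=
    (min_le_left _ _).trans (by push_cast at hup'; linarith)
  rw [dimBound_mul_succ, Int.floor_eq_iff]
  push_cast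
  constructor <;> linarith

lemma isKOptimal_of_finrank_add {ι : Type*} [Fintype ι] {C : Code ι} {r ℓ k : ℕ}
    (hn : Fintype.card ι = ℓ * (r + 1)) (hr : 2 ≤ r) (hℓ : 3 ≤ ℓ) (hC : HasLocality C r)
    (hd : 5 ≤ minDist C) (hfinrank : Module.finrank (ZMod 2) C + k = r * ℓ)
    (hlow : 2 ^ k < 2 + r * (r + 1) * ℓ) (hup : 2 + r * (r + 1) * ℓ ≤ 2 ^ (k + 1))
    (hk : k * (r + 2) ≤ r * ℓ) : IsKOptimal C r where
  locality := hC
  five_le_minDist := hd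
  two_le := hr
  le_half := by
    have hn' : (3 : ℝ) * (r + 1) ≤ Fintype.card ι := by
      exact_mod_cast hn ▸ Nat.mul_le_mul_right (r + 1) hℓ
    have hr' : (2 : ℝ) ≤ r := by exact_mod_cast hr
    linarith
  finrank_eq := by
    rw [hn, floor_dimBound hlow hup hk, eq_sub_iff_add_eq]
    exact_mod_cast hfinrank

end DimensionBound

section Parameters

variable {b s m z t k ℓ : ℕ}

lemma two_pow_le_of_div_lt (hb : 1 ≤ b) (hk : 1 ≤ k)
    (h : ((2 : ℝ) ^ (k - 1) - 1) / (2 ^ (b - 1) * (2 ^ b + 1)) < ℓ) :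
    2 ^ k ≤ 2 ^ b * (2 ^ b + 1) * ℓ := by
  obtain ⟨b, rfl⟩ := Nat.exists_eq_add_of_le' hb
  obtain ⟨k, rfl⟩ := Nat.exists_eq_add_of_le' hk
  rw [div_lt_iff₀ (by positivity), sub_lt_iff_lt_add, Nat.add_sub_cancel, Nat.add_sub_cancel] at h
  have hhalf : 2 ^ k ≤ ℓ * (2 ^ b * (2 ^ (b + 1) + 1)) := Nat.lt_succ_iff.1 (by exact_mod_cast h)
  calc 2 ^ (k + 1) = 2 * 2 ^ k := pow_succ' 2 k
    _ ≤ 2 * (ℓ * (2 ^ b * (2 ^ (b + 1) + 1))) := Nat.mul_le_mul_left 2 hhalf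
    _ = 2 ^ (b + 1) * (2 ^ (b + 1) + 1) * ℓ := by ring

lemma mul_two_pow_sub_one_add_le_of_le_div (ht : 0 < t)
    (h : (ℓ : ℝ) ≤ ((2 : ℝ) ^ m - 2 ^ t * (2 ^ z - 1) - 1) / (2 ^ t - 1)) :
    ℓ * (2 ^ t - 1) + 2 ^ t * 2 ^ z + 1 ≤ 2 ^ m + 2 ^ t := by
  have ht' : (1 : ℝ) < 2 ^ t := one_lt_pow₀ one_lt_two ht.ne'
  rw [le_div_iff₀ (sub_pos.2 ht')] at h
  have hreal : (ℓ : ℝ) * (2 ^ t - 1) + 2 ^ t * 2 ^ z + 1 ≤ 2 ^ m + 2 ^ t := by linarith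
  rw [← Nat.cast_le (α := ℝ)]
  push_cast [Nat.one_le_two_pow]
  exact hreal

lemma two_pow_mul_two_pow_add_one_le (hs : s < b) :
    2 ^ b * (2 ^ b + 1) ≤ 2 ^ (s + 1) * (2 ^ (2 * b - s) - 1) := by
  have hprod : 2 ^ (s + 1) * 2 ^ (2 * b - s) = 2 * (2 ^ b * 2 ^ b) := by
    rw [← pow_add, ← pow_add, ← pow_succ']
    congr 1
    omega
  have hs' : 2 ^ (s + 1) ≤ 2 ^ b := Nat.pow_le_pow_right two_pos hs
  have hb : 2 * 2 ^ b ≤ 2 ^ b * 2 ^ b := by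
    gcongr
    exact Nat.le_self_pow (by omega) 2
  rw [Nat.mul_sub_one, hprod, mul_add_one]
  omega

lemma two_pow_pred_le_mul_two_pow_sub_one (hs : s < b) (hm : 1 ≤ m)
    (h : 2 ^ (m + s) ≤ 2 ^ b * (2 ^ b + 1) * ℓ) : 2 ^ (m - 1) ≤ ℓ * (2 ^ (2 * b - s) - 1) := by
  refine Nat.le_of_mul_le_mul_left ?_ (pow_pos two_pos (s + 1))
  calc 2 ^ (s + 1) * 2 ^ (m - 1) = 2 ^ (m + s) := by rw [← pow_add]; congr 1; omega
    _ ≤ 2 ^ b * (2 ^ b + 1) * ℓ := h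
    _ ≤ 2 ^ (s + 1) * (2 ^ (2 * b - s) - 1) * ℓ :=
      Nat.mul_le_mul_right ℓ (two_pow_mul_two_pow_add_one_le hs)
    _ = 2 ^ (s + 1) * (ℓ * (2 ^ (2 * b - s) - 1)) := by ring

lemma two_add_le_two_pow (hs : s < b) (h : ℓ * (2 ^ (2 * b - s) - 1) + 1 ≤ 2 ^ m) :
    2 + 2 ^ b * (2 ^ b + 1) * ℓ ≤ 2 ^ (m + s + 1) := by
  have htwo : 2 ≤ 2 ^ (s + 1) := Nat.le_self_pow s.succ_ne_zero 2
  calc 2 + 2 ^ b * (2 ^ b + 1) * ℓ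
      ≤ 2 ^ (s + 1) + 2 ^ (s + 1) * (2 ^ (2 * b - s) - 1) * ℓ :=
      Nat.add_le_add htwo (Nat.mul_le_mul_right ℓ (two_pow_mul_two_pow_add_one_le hs))
    _ = 2 ^ (s + 1) * (ℓ * (2 ^ (2 * b - s) - 1) + 1) := by ring
    _ ≤ 2 ^ (s + 1) * 2 ^ m := Nat.mul_le_mul_left _ h
    _ = 2 ^ (m + s + 1) := by rw [← pow_add]; congr 1; omega

lemma six_mul_add_three_le_two_pow {y : ℕ} (hy : 4 ≤ y) : 6 * y + 3 ≤ 2 * 2 ^ y := by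
  induction y, hy using Nat.le_induction with
  | base => norm_num
  | succ y _ ih => rw [pow_succ]; omega

lemma mul_two_pow_add_two_le (hb : 2 ≤ b) (hk : 4 * b < k)
    (h : 2 ^ k ≤ 2 ^ b * (2 ^ b + 1) * ℓ) : k * (2 ^ b + 2) ≤ 2 ^ b * ℓ := by
  obtain ⟨y, rfl⟩ : ∃ y, k = 2 * b + 1 + y := ⟨k - (2 * b + 1), by omega⟩
  have hb' : 4 ≤ 2 ^ b := Nat.pow_le_pow_right two_pos hb
  have hℓ : 2 ^ y ≤ ℓ := by
    refine Nat.le_of_mul_le_mul_left ?_ (pow_pos two_pos (2 * b + 1))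
    calc 2 ^ (2 * b + 1) * 2 ^ y ≤ 2 ^ b * (2 ^ b + 1) * ℓ := pow_add 2 (2 * b + 1) y ▸ h
      _ ≤ 2 ^ b * (2 ^ b + 2 ^ b) * ℓ := by gcongr; omega
      _ = 2 ^ (2 * b + 1) * ℓ := by ring
  have hy := six_mul_add_three_le_two_pow (y := y) (by omega)
  refine Nat.le_of_mul_le_mul_left ?_ two_pos
  calc 2 * ((2 * b + 1 + y) * (2 ^ b + 2)) = (2 * b + 1 + y) * (2 * 2 ^ b + 4) := by ring
    _ ≤ (2 * y + 1) * (3 * 2 ^ b) := Nat.mul_le_mul (by omega) (by omega)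
    _ = 2 ^ b * (6 * y + 3) := by ring
    _ ≤ 2 ^ b * (2 * ℓ) := Nat.mul_le_mul_left _ (by omega)
    _ = 2 * (2 ^ b * ℓ) := by ring

lemma exists_isPartialSpread (ht : 0 < t) (hz : z ≡ m [MOD t]) (hℓ : 0 < ℓ)
    (h : ℓ * (2 ^ t - 1) + 2 ^ t * 2 ^ z + 1 ≤ 2 ^ m + 2 ^ t) :
    ∃ W : Fin ℓ → Submodule (ZMod 2) (Fin m → ZMod 2), IsPartialSpread t W := by
  obtain ⟨T, hT⟩ : ∃ T, 2 ^ t = T + 1 := Nat.exists_eq_add_of_le' Nat.one_le_two_pow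
  have hT_pos : 0 < T := by have := Nat.one_lt_two_pow ht.ne'; omega
  have hzm : t + z ≤ m := by
    refine (Nat.pow_le_pow_iff_right one_lt_two).1 ?_
    rw [pow_add]
    have : T ≤ ℓ * T := Nat.le_mul_of_pos_left T hℓ
    rw [hT, Nat.add_sub_cancel] at h
    rw [hT]
    omega
  obtain ⟨k, hk⟩ := (Nat.modEq_iff_dvd' (by omega)).1 hz
  obtain rfl : m = k * t + z := by rw [mul_comm k, ← hk]; omega
  have hk_pos : 1 ≤ k := Nat.one_le_iff_ne_zero.2 (by rintro rfl; omega)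
  obtain ⟨N, hN, hspread⟩ := exists_hasPartialSpread (ZMod 2) z ht hk_pos
  have hℓN : ℓ ≤ N := by
    rw [Nat.card_zmod, hT] at hN
    rw [hT, Nat.add_sub_cancel] at h
    refine Nat.le_of_mul_le_mul_right ?_ hT_pos
    linarith
  obtain ⟨W, hW, hdisj⟩ := hspread.mono hℓN
  exact ⟨W, hW, fun i j hij => (hdisj hij).eq_bot⟩

end Parameters

end BinaryLRC

theorem theorem4_general (b s m z ℓ : ℕ) (hb : 2 ≤ b) (hs : s < b) (hm : 4 * b < m + s)
    (hz : z ≡ m [MOD (2 * b - s)])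
    (hℓ : ((2 : ℝ) ^ (m + s - 1) - 1) / (2 ^ (b - 1) * (2 ^ b + 1)) < ℓ)
    (hℓ' : (ℓ : ℝ) ≤
      ((2 : ℝ) ^ m - 2 ^ (2 * b - s) * (2 ^ z - 1) - 1) / (2 ^ (2 * b - s) - 1)) :
    (∃ W : Fin ℓ → Submodule (ZMod 2) (Fin m → ZMod 2),
      BinaryLRC.IsPartialSpread (2 * b - s) W) ∧
    ∀ (A : Matrix (Fin s ⊕ Fin (2 * b - s)) (Fin (2 ^ b)) (ZMod 2)), BinaryLRC.IsDesired A →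
    ∀ (W : Fin ℓ → Submodule (ZMod 2) (Fin m → ZMod 2)),
      BinaryLRC.IsPartialSpread (2 * b - s) W →
      ∀ (e : ∀ i, Module.Basis (Fin (2 * b - s)) (ZMod 2) (W i))
        (GU : Matrix (Fin s) (Fin s) (ZMod 2)), LinearIndependent (ZMod 2) GU.col →
        Fintype.card (Fin ℓ × Fin (2 ^ b + 1)) = (2 ^ b + 1) * ℓ ∧
        (Module.finrank (ZMod 2) (BinaryLRC.spreadCode GU e A) : ℤ) =
          (2 ^ b + 1) * ℓ - ℓ - m - s ∧
        6 ≤ BinaryLRC.minDist (BinaryLRC.spreadCode GU e A) ∧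
        BinaryLRC.HasLocality (BinaryLRC.spreadCode GU e A) (2 ^ b) ∧
        BinaryLRC.HasDisjointRepairGroups (BinaryLRC.spreadCode GU e A) (2 ^ b) ℓ ∧
        BinaryLRC.IsKOptimal (BinaryLRC.spreadCode GU e A) (2 ^ b) := by
  have hup := BinaryLRC.mul_two_pow_sub_one_add_le_of_le_div (by omega) hℓ'
  have hlow := BinaryLRC.two_pow_le_of_div_lt (by omega) (by omega) hℓ
  have hk := BinaryLRC.mul_two_pow_add_two_le hb hm hlow
  have hkℓ : m + s ≤ ℓ := Nat.le_of_mul_le_mul_left (by linarith) (pow_pos two_pos b)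
  have hr : 4 ≤ 2 ^ b := Nat.pow_le_pow_right two_pos hb
  refine ⟨BinaryLRC.exists_isPartialSpread (by omega) hz (by omega) hup,
    fun A hA W hW e GU hGU => ?_⟩
  have hspan := hW.iSup_eq_top (BinaryLRC.two_pow_pred_le_mul_two_pow_sub_one hs (by omega) hlow)
  have hfinrank : Module.finrank (ZMod 2) (BinaryLRC.spreadCode GU e A) + (m + s) = 2 ^ b * ℓ := by
    linarith [BinaryLRC.finrank_spreadCode (e := e) hA.rank_eq hspan (by omega) hGU]
  have hd : 6 ≤ BinaryLRC.minDist (BinaryLRC.spreadCode GU e A) := by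
    refine BinaryLRC.le_minDist (fun hbot => ?_) fun c hc =>
      BinaryLRC.eq_zero_of_mem_spreadCode hA (by omega) hr hW hGU hc
    rw [hbot, finrank_bot] at hfinrank
    linarith [Nat.mul_le_mul_right ℓ hr]
  have hgroups := BinaryLRC.hasDisjointRepairGroups_spreadCode (GU := GU) (e := e) (A := A)
  refine ⟨hgroups.1, ?_, hd, hgroups.hasLocality, hgroups, ?_⟩
  · zify at hfinrank
    linarith
  · refine BinaryLRC.isKOptimal_of_finrank_add (by simp) (by omega) (by omega) hgroups.hasLocality
      (by omega) hfinrank (hlow.trans_lt (by omega)) (BinaryLRC.two_add_le_two_pow hs ?_) hk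
    linarith [Nat.le_mul_of_pos_right (2 ^ (2 * b - s)) (Nat.two_pow_pos z)]

theorem theorem4 (b s m z ℓ : ℕ) (hb : 3 ≤ b) (hs₁ : 1 ≤ s) (hs : s < b) (hm : 4 * b ≤ m)
    (hz₁ : 1 ≤ z) (hz : z ≡ m [MOD (2 * b - s)]) (hzb : z ≤ b)
    (hℓ : ((2 : ℝ) ^ (m + s - 1) - 1) / (2 ^ (b - 1) * (2 ^ b + 1)) < ℓ)
    (hℓ' : (ℓ : ℝ) ≤
      ((2 : ℝ) ^ m - 2 ^ (2 * b - s) * (2 ^ z - 1) - 1) / (2 ^ (2 * b - s) - 1)) :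
    (∃ W : Fin ℓ → Submodule (ZMod 2) (Fin m → ZMod 2),
      BinaryLRC.IsPartialSpread (2 * b - s) W) ∧
    ∀ (A : Matrix (Fin s ⊕ Fin (2 * b - s)) (Fin (2 ^ b)) (ZMod 2)), BinaryLRC.IsDesired A →
    ∀ (W : Fin ℓ → Submodule (ZMod 2) (Fin m → ZMod 2)),
      BinaryLRC.IsPartialSpread (2 * b - s) W →
      ∀ (e : ∀ i, Module.Basis (Fin (2 * b - s)) (ZMod 2) (W i))
        (GU : Matrix (Fin s) (Fin s) (ZMod 2)), LinearIndependent (ZMod 2) GU.col →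
        Fintype.card (Fin ℓ × Fin (2 ^ b + 1)) = (2 ^ b + 1) * ℓ ∧
        (Module.finrank (ZMod 2) (BinaryLRC.spreadCode GU e A) : ℤ) =
          (2 ^ b + 1) * ℓ - ℓ - m - s ∧
        6 ≤ BinaryLRC.minDist (BinaryLRC.spreadCode GU e A) ∧
        BinaryLRC.HasLocality (BinaryLRC.spreadCode GU e A) (2 ^ b) ∧
        BinaryLRC.HasDisjointRepairGroups (BinaryLRC.spreadCode GU e A) (2 ^ b) ℓ ∧
        BinaryLRC.IsKOptimal (BinaryLRC.spreadCode GU e A) (2 ^ b) :=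
  theorem4_general b s m z ℓ (by omega) hs (by omega) hz hℓ hℓ'
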